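/- **Setting.** A stationary process over a finite alphabet is given by its shift-invariant word probabilities. A (causal) input-output process is presented by a finite-state transducer with matrices $T^{(y|x)}_{ij}=\Pr(Y_t=y,S_{t+1}=j\mid X_t=x,S_t=i)$; the transducer is the $\epsilon$-transducer if it is unifilar, every joint input-output past that can occur determines the current state, every state arises from such a past, and two such pasts give the same state exactly when they have the same output word probabilities conditional on all future inputs. When a transducer $A$ is driven by a stationary process $I$ and the resulting stationary joint law of states and inputs is unique, let $\pi$ be the stationary distribution of its states; the outputs form a stationary process $O$, and we say that $A$ maps $I$ to $O$. The classical (statistical) complexity is the Shannon entropy in bits $C^A_I=-\sum_i\pi_i\log_2\pi_i$, where $A$ is the $\epsilon$-transducer. A quantum model of $A$ consists of unit vectors $|\sigma_i\rangle$ in a finite-dimensional memory space and a unitary $U$ on memory, input tape, output tape and a finite-dimensional ancilla with $$U|\sigma_i\rangle|x\rangle|0\rangle|0\rangle=\sum_{y}\sum_j\sqrt{T^{(y|x)}_{ij}}\,|\sigma_j\rangle|x\rangle|y\rangle|\psi_{i,x,y}\rangle$$ for all $i$, $x$ and some unit "junk" vectors $|\psi_{i,x,y}\rangle$. Its cost is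 the von Neumann entropy $-\mathrm{tr}(\rho\log_2\rho)$ of $\rho=\sum_i\pi_i|\sigma_i\rangle\langle\sigma_i|$, and the quantum complexity $Q^A_I$ is the infimum of the costs of all quantum models. The product encoding is $|s_i\rangle=\bigotimes_x|s_i^x\rangle$ with $|s_i^x\rangle=\sum_{k,y}\sqrt{T^{(y|x)}_{ik}}\,|y\rangle|k\rangle$. **The processes** (all alphabets are $\{0,1,2\}$; "$y|x:t$" means "on input $x$, output $y$ with probability $t$"). - $I$ is the stationary process of the two-state model in which $r_0$ moves to $r_1$, emitting $1$ or $2$ with probability $\tfrac12$ each, and $r_1$ emits $0$ and moves to $r_0$ with probability $\tfrac12$, or emits $1$ and stays at $r_1$ with probability $\tfrac12$. - $A$ has states $\sigma_0,\sigma_1,\sigma_2$; after output $y$ it is in state $\sigma_y$. From every state $0|0:1$ and $2|2:1$; on input $1$ the output is $1$ with probability $p,q,r$ from $\sigma_0,\sigma_1,\sigma_2$ respectively, and $2$ otherwise. Here $p=0$, $q=\tfrac13$, $r=\tfrac14$. - $A^{-1}$ has states $\phi_0,\phi_1$; after input $0$ it is in state $\phi_0$, after input $1$ or $2$ in state $\phi_1$.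 From both states $0|0:1$ and $1|1:1$; on input $2$, from $\phi_0$, $1|2:\frac{1-p}{2-p}$ and $2|2:\frac1{2-p}$ (both equal to $\tfrac12$ for $p=0$), and from $\phi_1$, $1|2:1$. **Result.** Both transducers are $\epsilon$-transducers. $A$ maps $I$ to a stationary process $O$, and $A^{-1}$ maps $O$ back to $I$, so $A^{-1}$ is an inverse of $A$ for the input $I$ (in both cases the stationary joint law of states and inputs is unique). The complexities satisfy $$1.290\le C^A_I<1.291,\qquad 0.918\le C^{A^{-1}}_O<0.919,\qquad C^A_I>C^{A^{-1}}_O .$$ The product encoding is realized by a quantum model of $A$ whose cost $q_A$ satisfies $0.336\le q_A<0.337$, so that $Q^A_I\le q_A$. The product encoding is also realized by a quantum model of $A^{-1}$, and this model is optimal: its cost is the minimum over all quantum models of $A^{-1}$, and $$0.550\le Q^{A^{-1}}_O<0.551 .$$ Consequently $Q^A_I<Q^{A^{-1}}_O$, so the classical and the quantum orderings disagree. -/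

import Mathlib

namespace AgentComplexity

open Matrix

/-- A stationary stochastic process over a finite alphabet `X`, given by its word probabilities
`prob [x₀, …, x_{L-1}] = Pr (X_t = x₀, …, X_{t+L-1} = x_{L-1})`, which do not depend on `t`. -/
@[ext]
structure StationaryProcess (X : Type) [Fintype X] where
  prob : List X → ℝ
  nonneg : ∀ w, 0 ≤ prob w
  nil : prob [] = 1
  sum_append : ∀ w, ∑ x, prob (w ++ [x]) = prob w
  sum_cons : ∀ w, ∑ x, prob (x :: w) = prob w

/-- An edge-emitting hidden Markov model: `mat x i j = Pr (X_t = x, R_{t+1} = j | R_t = i)`. -/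
structure HMM (X R : Type) [Fintype X] [Fintype R] where
  mat : X → Matrix R R ℝ
  nonneg : ∀ x i j, 0 ≤ mat x i j
  sum_one : ∀ i, ∑ x, ∑ j, mat x i j = 1

/-- Probability that the model emits the word `w` when started in state `i`. -/
def HMM.wordProb {X R : Type} [Fintype X] [Fintype R] (M : HMM X R) : R → List X → ℝ
  | _, [] => 1
  | i, x :: w => ∑ j, M.mat x i j * M.wordProb j w

theorem HMM.wordProb_nonneg {X R : Type} [Fintype X] [Fintype R] (M : HMM X R) (i : R)
    (w : List X) : 0 ≤ M.wordProb i w := by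
  induction w generalizing i with
  | nil => simp [HMM.wordProb]
  | cons x w ih => exact Finset.sum_nonneg fun j _ => mul_nonneg (M.nonneg x i j) (ih j)

theorem HMM.sum_wordProb_append {X R : Type} [Fintype X] [Fintype R] (M : HMM X R) (i : R)
    (w : List X) : ∑ x, M.wordProb i (w ++ [x]) = M.wordProb i w := by
  induction w generalizing i with
  | nil => simpa [HMM.wordProb] using M.sum_one i
  | cons a w ih =>
    simp only [List.cons_append, HMM.wordProb]
    rw [Finset.sum_comm]
    exact Finset.sum_congr rfl fun j _ => by rw [← Finset.mul_sum, ih]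

/-- The stationary process generated by a hidden Markov model whose initial state is distributed
according to a stationary distribution `p` (a left eigenvector of `∑ x, mat x`). -/
def HMM.process {X R : Type} [Fintype X] [Fintype R] (M : HMM X R) (p : R → ℝ)
    (p_nonneg : ∀ i, 0 ≤ p i) (p_sum : ∑ i, p i = 1)
    (p_stat : ∀ j, ∑ x, ∑ i, p i * M.mat x i j = p j) : StationaryProcess X where
  prob w := ∑ i, p i * M.wordProb i w
  nonneg w := Finset.sum_nonneg fun i _ => mul_nonneg (p_nonneg i) (M.wordProb_nonneg i w)
  nil := by simpa [HMM.wordProb] using p_sum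
  sum_append w := by
    rw [Finset.sum_comm]
    exact Finset.sum_congr rfl fun i _ => by rw [← Finset.mul_sum, M.sum_wordProb_append]
  sum_cons w := by
    calc ∑ x, ∑ i, p i * M.wordProb i (x :: w)
        = ∑ x, ∑ i, ∑ j, p i * M.mat x i j * M.wordProb j w := by
          simp only [HMM.wordProb, Finset.mul_sum, mul_assoc]
      _ = ∑ x, ∑ j, ∑ i, p i * M.mat x i j * M.wordProb j w :=
          Finset.sum_congr rfl fun x _ => Finset.sum_comm
      _ = ∑ j, ∑ x, ∑ i, p i * M.mat x i j * M.wordProb j w := Finset.sum_comm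
      _ = ∑ j, (∑ x, ∑ i, p i * M.mat x i j) * M.wordProb j w := by simp only [Finset.sum_mul]
      _ = ∑ j, p j * M.wordProb j w := by simp only [p_stat]

/-- A (causal) input-output process presented by a transducer with finite state set `S`:
`mat x y i j = T^{(y|x)}_{ij} = Pr (Y_t = y, S_{t+1} = j | X_t = x, S_t = i)`. -/
structure Transducer (X Y S : Type) [Fintype X] [Fintype Y] [Fintype S] where
  mat : X → Y → Matrix S S ℝ
  nonneg : ∀ x y i j, 0 ≤ mat x y i j
  sum_one : ∀ x i, ∑ y, ∑ j, mat x y i j = 1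

section Transducer

variable {X Y S : Type} [Fintype X] [Fintype Y] [Fintype S]

/-- `A.wordProb i [(x₀, y₀), …, (x_L, y_L)] = Pr (Y_{0:L+1} = y₀…y_L | X_{0:L+1} = x₀…x_L, S₀ = i)`:
the conditional output word probabilities (the future morph) of the state `i`. -/
def Transducer.wordProb (A : Transducer X Y S) : S → List (X × Y) → ℝ
  | _, [] => 1
  | i, (x, y) :: w => ∑ j, A.mat x y i j * A.wordProb j w

/-- `s` is a possible sequence of states along the semi-infinite joint input-output past `z`. Time
runs backwards: `z 0` is the last input-output pair, and `s 0` is the present state. -/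
def Transducer.IsRun (A : Transducer X Y S) (z : ℕ → X × Y) (s : ℕ → S) : Prop :=
  ∀ n, 0 < A.mat (z n).1 (z n).2 (s (n + 1)) (s n)

/-- The transducer `A` is the ε-transducer of the channel that it presents, with encoding function
`ε` from joint pasts to causal states: it is unifilar; a past `z` that can occur determines the
present state, `ε z`, so that `A.wordProb (ε z)` gives the output probabilities conditional on
future inputs and on the past `z`; every state arises from some past; and two pasts that can occur
have the same state exactly when these conditional output probabilities agree. -/
structure Transducer.IsEpsilonTransducer (A : Transducer X Y S) (ε : (ℕ → X × Y) → S) : Prop where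
  unifilar : ∀ x y i j j', 0 < A.mat x y i j → 0 < A.mat x y i j' → j = j'
  encodes : ∀ z s, A.IsRun z s → s 0 = ε z
  onto : ∀ i, ∃ z s, A.IsRun z s ∧ s 0 = i
  causal : ∀ z z', (∃ s, A.IsRun z s) → (∃ s, A.IsRun z' s) →
    (ε z = ε z' ↔ ∀ w, A.wordProb (ε z) w = A.wordProb (ε z') w)

/-- `V` is a stationary law of the channel `A` driven by the process `I`:
`V i [x₀, …, x_{L-1}] = Pr (S_t = i, X_t = x₀, …, X_{t+L-1} = x_{L-1})` for every `t`, the inputs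
being distributed as `I` and the state being updated according to `A`. -/
structure Transducer.IsStationaryLaw (A : Transducer X Y S) (I : StationaryProcess X)
    (V : S → List X → ℝ) : Prop where
  nonneg : ∀ i w, 0 ≤ V i w
  input : ∀ w, ∑ i, V i w = I.prob w
  consistent : ∀ i w, ∑ x, V i (w ++ [x]) = V i w
  stationary : ∀ j w, V j w = ∑ x, ∑ i, V i (x :: w) * ∑ y, A.mat x y i j

/-- The word probabilities of the joint process over inputs and outputs. -/
def Transducer.jointProb (A : Transducer X Y S) (V : S → List X → ℝ) (w : List (X × Y)) : ℝ :=
  ∑ i, V i (w.map Prod.fst) * A.wordProb i w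

/-- `sumInputs g [y₀, …, y_L]` is the sum of `g [(x₀, y₀), …, (x_L, y_L)]` over all input words
`x₀ … x_L`. -/
def sumInputs : (List (X × Y) → ℝ) → List Y → ℝ
  | g, [] => g []
  | g, y :: v => ∑ x, sumInputs (fun w => g ((x, y) :: w)) v

/-- Driven by the process `I`, the channel `A` has the unique stationary law `V`, and its outputs
form the stationary process `O`. -/
structure Transducer.Maps (A : Transducer X Y S) (I : StationaryProcess X)
    (V : S → List X → ℝ) (O : StationaryProcess Y) : Prop where
  law : A.IsStationaryLaw I V
  unique : ∀ V', A.IsStationaryLaw I V' → V' = V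
  output : ∀ v, O.prob v = sumInputs (A.jointProb V) v

/-- The stationary distribution over the states of the transducer. -/
def stateDist (V : S → List X → ℝ) (i : S) : ℝ := V i []

/-- Shannon entropy in bits. For the stationary distribution over the states of the ε-transducer
of a channel driven by an input process, this is the statistical complexity. -/
noncomputable def shannonEntropy (p : S → ℝ) : ℝ := ∑ i, Real.negMulLog (p i) / Real.log 2

/-- Von Neumann entropy `-tr (ρ log₂ ρ)`, in bits. -/
noncomputable def vonNeumannEntropy {n : Type} [Fintype n] [DecidableEq n] {ρ : Matrix n n ℂ}
    (hρ : ρ.IsHermitian) : ℝ := ∑ k, Real.negMulLog (hρ.eigenvalues k) / Real.log 2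

/-- The average memory state `∑ i, p i |σ i⟩⟨σ i|`. -/
def avgState {n : Type} (p : S → ℝ) (σ : S → n → ℂ) : Matrix n n ℂ :=
  ∑ i, (p i : ℂ) • vecMulVec (σ i) (star (σ i))

theorem avgState_isHermitian {n : Type} (p : S → ℝ) (σ : S → n → ℂ) :
    (avgState p σ).IsHermitian := by
  simp [avgState, Matrix.IsHermitian, Matrix.conjTranspose_sum, Matrix.conjTranspose_smul,
    Matrix.conjTranspose_vecMulVec]

/-- Entropy of the average memory state of an encoding `σ` of the causal states. -/
noncomputable def memoryEntropy {n : Type} [Fintype n] [DecidableEq n] (p : S → ℝ)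
    (σ : S → n → ℂ) : ℝ := vonNeumannEntropy (avgState_isHermitian p σ)

/-- The product vector `u ⊗ v ⊗ w ⊗ t`. -/
def tensor {n K : Type} (u : n → ℂ) (v : X → ℂ) (w : Y → ℂ) (t : K → ℂ) : n × X × Y × K → ℂ :=
  fun a => u a.1 * v a.2.1 * w a.2.2.1 * t a.2.2.2

/-- A quantum model (quantum agent) of an ε-transducer, with memory space `ℂⁿ` and an ancilla
space `ℂᴷ`. Each causal state `i` is encoded in a pure state `|σ i⟩`, and a unitary `U` acting on
memory, input tape, output tape and ancilla satisfies
`U |σ i⟩|x⟩|y₀⟩|k₀⟩ = ∑ y, ∑ j, √T^{(y|x)}_{ij} |σ j⟩|x⟩|y⟩|ψ i x y⟩`.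
Measuring the output tape in the computational basis yields `y` with the correct probability and
leaves the memory in the correct next state; the states `ψ` are discarded. -/
structure QuantumModel [DecidableEq X] [DecidableEq Y] (A : Transducer X Y S)
    (n K : Type) [Fintype n] [DecidableEq n] [Fintype K] [DecidableEq K] where
  state : S → n → ℂ
  state_unit : ∀ i, ∑ a, ‖state i a‖ ^ 2 = 1
  blankOutput : Y
  blankAncilla : K
  junk : S → X → Y → K → ℂ
  junk_unit : ∀ i x y, ∑ k, ‖junk i x y k‖ ^ 2 = 1
  U : Matrix.unitaryGroup (n × X × Y × K) ℂ
  evolution : ∀ i x,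
    (U : Matrix (n × X × Y × K) (n × X × Y × K) ℂ) *ᵥ
        tensor (state i) (Pi.single x 1) (Pi.single blankOutput 1) (Pi.single blankAncilla 1) =
      ∑ y, ∑ j, (Real.sqrt (A.mat x y i j) : ℂ) •
        tensor (state j) (Pi.single x 1) (Pi.single y 1) (junk i x y)

/-- `σ` is the family of memory states of some quantum model of `A`. -/
def IsQuantumEncoding [DecidableEq X] [DecidableEq Y] (A : Transducer X Y S)
    {n : Type} [Fintype n] [DecidableEq n] (σ : S → n → ℂ) : Prop :=
  ∃ (K : Type) (_ : Fintype K) (_ : DecidableEq K) (Q : QuantumModel A n K), Q.state = σ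

/-- The memory entropies of all quantum models of `A` when its stationary distribution is `p`. The
quantum complexity, that is, the quantum complexity of an optimal model, is the greatest lower
bound of this set. -/
def quantumCosts [DecidableEq X] [DecidableEq Y] (A : Transducer X Y S) (p : S → ℝ) : Set ℝ :=
  {e | ∃ (n : Type) (_ : Fintype n) (_ : DecidableEq n) (σ : S → n → ℂ),
    IsQuantumEncoding A σ ∧ e = memoryEntropy p σ}

/-- The encoding `|s_i⟩ = ⨂ x, |s_i^x⟩` with `|s_i^x⟩ = ∑ k, ∑ y, √T^{(y|x)}_{ik} |y⟩|k⟩`; the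
standard basis of `⨂ x, (ℂ^Y ⊗ ℂ^S)` is indexed by functions `X → Y × S`. -/
noncomputable def productEncoding (A : Transducer X Y S) (i : S) : (X → Y × S) → ℂ :=
  fun f => ∏ x, (Real.sqrt (A.mat x (f x).1 i (f x).2) : ℂ)

end Transducer

/-- The two-state hidden Markov model of the input stimulus: from `r₀`, the symbols `1` and `2` are
emitted with probability `1/2` each, moving to `r₁`; from `r₁`, the symbol `0` is emitted with
probability `1/2`, moving to `r₀`, and `1` with probability `1/2`, staying in `r₁`. -/
noncomputable def inputHMM : HMM (Fin 3) (Fin 2) where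
  mat := ![!![0, 0; 1 / 2, 0], !![0, 1 / 2; 0, 1 / 2], !![0, 1 / 2; 0, 0]]
  nonneg x i j := by
    fin_cases x <;> fin_cases i <;> fin_cases j <;> simp
  sum_one i := by
    fin_cases i <;> simp [Fin.sum_univ_three, Fin.sum_univ_two] <;> norm_num

/-- The input process. -/
noncomputable def inputProcess : StationaryProcess (Fin 3) :=
  inputHMM.process ![1 / 3, 2 / 3]
    (fun i => by fin_cases i <;> norm_num)
    (by simp [Fin.sum_univ_two]; norm_num)
    (fun j => by
      fin_cases j <;> simp [inputHMM, Fin.sum_univ_three, Fin.sum_univ_two] <;> norm_num)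

/-- Transition matrices of the three-state input-output process with parameters `p`, `q`, `r`; row
`x` and column `y` of the table hold the matrix `T^{(y|x)}`. -/
noncomputable def agentMat (p q r : ℝ) : Fin 3 → Fin 3 → Matrix (Fin 3) (Fin 3) ℝ :=
  ![![!![1, 0, 0; 1, 0, 0; 1, 0, 0], 0, 0],
    ![0, !![0, p, 0; 0, q, 0; 0, r, 0], !![0, 0, 1 - p; 0, 0, 1 - q; 0, 0, 1 - r]],
    ![0, 0, !![0, 0, 1; 0, 0, 1; 0, 0, 1]]]

theorem agentMat_nonneg {p q r : ℝ} (hp0 : 0 ≤ p) (hp1 : p ≤ 1) (hq0 : 0 ≤ q) (hq1 : q ≤ 1)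
    (hr0 : 0 ≤ r) (hr1 : r ≤ 1) : ∀ x y i j, 0 ≤ agentMat p q r x y i j := by
  simp [Fin.forall_fin_succ, agentMat, *]

theorem agentMat_sum (p q r : ℝ) : ∀ x i, ∑ y, ∑ j, agentMat p q r x y i j = 1 := by
  simp [Fin.forall_fin_succ, agentMat, Fin.sum_univ_three]

/-- The three-state input-output process with parameters `p`, `q`, `r`. -/
noncomputable def agent (p q r : ℝ) (hp : p ∈ Set.Icc (0 : ℝ) 1) (hq : q ∈ Set.Icc (0 : ℝ) 1)
    (hr : r ∈ Set.Icc (0 : ℝ) 1) : Transducer (Fin 3) (Fin 3) (Fin 3) where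
  mat := agentMat p q r
  nonneg := agentMat_nonneg hp.1 hp.2 hq.1 hq.2 hr.1 hr.2
  sum_one := agentMat_sum p q r

/-- Transition matrices of the two-state inverse input-output process. Its inputs `y` are the
outputs of `agent`; row `y` and column `x` of the table hold the matrix of the transitions `x|y`. -/
noncomputable def inverseMat (p : ℝ) : Fin 3 → Fin 3 → Matrix (Fin 2) (Fin 2) ℝ :=
  ![![!![1, 0; 1, 0], 0, 0],
    ![0, !![0, 1; 0, 1], 0],
    ![0, !![0, (1 - p) / (2 - p); 0, 1], !![0, 1 / (2 - p); 0, 0]]]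

theorem inverseMat_nonneg {p : ℝ} (hp : p ≤ 1) : ∀ x y i j, 0 ≤ inverseMat p x y i j := by
  have h1 : 0 ≤ (1 - p) / (2 - p) := div_nonneg (by linarith) (by linarith)
  have h2 : p ≤ 2 := by linarith
  simp [Fin.forall_fin_succ, inverseMat, *]

theorem inverseMat_sum {p : ℝ} (hp : p ≤ 1) :
    ∀ x i, ∑ y, ∑ j, inverseMat p x y i j = 1 := by
  have h : 2 - p ≠ 0 := by linarith
  have h1 : (1 - p) / (2 - p) + (2 - p)⁻¹ = 1 := by
    field_simp
    ring
  simp [Fin.forall_fin_succ, inverseMat, Fin.sum_univ_three, h1]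

/-- The two-state inverse input-output process. -/
noncomputable def inverseAgent (p : ℝ) (hp : p ∈ Set.Icc (0 : ℝ) 1) :
    Transducer (Fin 3) (Fin 3) (Fin 2) where
  mat := inverseMat p
  nonneg := inverseMat_nonneg hp.2
  sum_one := inverseMat_sum hp.2

/-- The process `A`: `p = 0`, `q = 1/3`, `r = 1/4`. -/
noncomputable def agentA : Transducer (Fin 3) (Fin 3) (Fin 3) :=
  agent 0 (1 / 3) (1 / 4) (by norm_num) (by norm_num) (by norm_num)

/-- The inverse process of `A`. -/
noncomputable def agentAInv : Transducer (Fin 3) (Fin 3) (Fin 2) :=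
  inverseAgent 0 (by norm_num)

end AgentComplexity

open AgentComplexity

namespace AgentComplexity

open Matrix

/-! The last output of `agentA` determines both its own state and the state of the input generator:
output 0 goes with `r₀`, outputs 1 and 2 with `r₁`. Hence the stationary laws are explicit, the
output is a three-state Markov chain, and merging its states 1 and 2 through the inverse gives back
the input (`sumInputs_wordProb_mul_wordProb`). Uniqueness of the law of `agentA` comes from a
contraction.

The quantum part rests on two facts. The entropy of an encoding depends only on its weighted Gram
matrix, since `M * N` and `N * M` have the same nonzero spectrum (`memoryEntropy_eq_sum_roots`). And
a unitary evolution exists exactly when the overlaps are preserved (`isQuantumEncoding_of_overlap`,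
`QuantumModel.overlap_eq`).

For `agentAInv`, input 2 forces the squared overlap of the two memory states to be at most 1/2
(`QuantumModel.norm_overlap_sq_le`). The product encoding attains this bound, so it is optimal. For
`agentA` only the cost of the product encoding is needed: its three vectors are nearly parallel, and
the cost, a binary entropy, lies below the optimum of the inverse. -/

/-! ### Unitaries from equal Gram matrices. -/

theorem exists_linearIsometry_of_inner_eq {ι E : Type*} [Fintype ι] [NormedAddCommGroup E]
    [InnerProductSpace ℂ E] [FiniteDimensional ℂ E] (u v : ι → E)
    (h : ∀ i j, inner ℂ (u i) (u j) = inner ℂ (v i) (v j)) :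
    ∃ L : E →ₗᵢ[ℂ] E, ∀ i, L (u i) = v i := by
  classical
  set f := Fintype.linearCombination ℂ u with hf
  set g := Fintype.linearCombination ℂ v with hg
  have norm_eq : ∀ c, ‖g c‖ = ‖f c‖ := by
    intro c
    have : inner ℂ (g c) (g c) = inner ℂ (f c) (f c) := by
      simp only [hf, hg, Fintype.linearCombination_apply, sum_inner, inner_sum, inner_smul_left,
        inner_smul_right, h]
    rw [@norm_eq_sqrt_re_inner ℂ, @norm_eq_sqrt_re_inner ℂ, this]
  -- Equal norms force `g` to vanish on the kernel of `f`, so `g ∘ₗ s` sends `f c` to `g c`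
  -- whichever section `s` is chosen. Finite dimension then lets the isometry extend from the range
  -- of `f` to all of `E`.
  obtain ⟨s, hs⟩ := f.rangeRestrict.exists_rightInverse_of_surjective f.range_rangeRestrict
  have fs : ∀ x, f (s x) = x := fun x => congrArg Subtype.val (LinearMap.congr_fun hs x)
  let L : LinearMap.range f →ₗᵢ[ℂ] E :=
    { toLinearMap := g ∘ₗ s
      norm_map' := fun x => by
        rw [LinearMap.comp_apply, norm_eq, fs, Submodule.coe_norm] }
  refine ⟨L.extend, fun i => ?_⟩
  have hu : u i = f (Pi.single i 1) := by simp [hf]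
  have hv : v i = g (Pi.single i 1) := by simp [hg]
  have hx : L.extend (f (Pi.single i 1)) = L ⟨f (Pi.single i 1), ⟨_, rfl⟩⟩ :=
    L.extend_apply ⟨f (Pi.single i 1), ⟨_, rfl⟩⟩
  rw [hu, hv, hx, ← sub_eq_zero, ← norm_eq_zero]
  change ‖g (s _) - g _‖ = 0
  rw [← map_sub, norm_eq, map_sub, fs, sub_self, norm_zero]

theorem exists_unitary_mulVec {ι N : Type*} [Fintype ι] [Fintype N] [DecidableEq N]
    (u v : ι → N → ℂ) (h : ∀ i j, star (u i) ⬝ᵥ u j = star (v i) ⬝ᵥ v j) :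
    ∃ U : unitaryGroup N ℂ, ∀ i, (U : Matrix N N ℂ) *ᵥ u i = v i := by
  obtain ⟨L, hL⟩ := exists_linearIsometry_of_inner_eq
    (fun i => WithLp.toLp 2 (u i)) (fun i => WithLp.toLp 2 (v i)) (fun i j => by
      simpa [EuclideanSpace.inner_eq_star_dotProduct, dotProduct_comm] using h i j)
  let e := L.toLinearIsometryEquiv rfl
  let b := EuclideanSpace.basisFun N ℂ
  refine ⟨⟨_, e.toMatrix_mem_unitaryGroup b b⟩, fun i => ?_⟩
  have := LinearMap.toMatrix_mulVec_repr b.toBasis b.toBasis e.toLinearEquiv.toLinearMap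
    (WithLp.toLp 2 (u i))
  have h2 : e.toLinearEquiv (WithLp.toLp 2 (u i)) = WithLp.toLp 2 (v i) := hL i
  ext a
  have h3 := congrFun this a
  simp only [OrthonormalBasis.coe_toBasis_repr_apply, LinearEquiv.coe_coe] at h3
  have h4 : ⇑(b.toBasis.repr (WithLp.toLp 2 (u i))) = u i := by
    ext c
    simp [b]
  rw [h4] at h3
  rw [h3, h2]
  simp [b]

/-! ### Entropy of an average state through its Gram matrix. -/

/-- The contribution of an eigenvalue to the von Neumann entropy. -/
noncomputable def entropyTerm (z : ℂ) : ℝ := Real.negMulLog z.re / Real.log 2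

theorem vonNeumannEntropy_eq_sum_roots {n : Type} [Fintype n] [DecidableEq n] {ρ : Matrix n n ℂ}
    (hρ : ρ.IsHermitian) :
    vonNeumannEntropy hρ = (ρ.charpoly.roots.map entropyTerm).sum := by
  rw [hρ.roots_charpoly_eq_eigenvalues, Multiset.map_map]
  simp [vonNeumannEntropy, entropyTerm]

/-- Zero eigenvalues carry no entropy, so memory spaces of different dimensions can be compared. -/
theorem sum_entropyTerm_roots_X_pow_mul {P : Polynomial ℂ} (hP : P ≠ 0) (a : ℕ) :
    ((Polynomial.X ^ a * P).roots.map entropyTerm).sum = (P.roots.map entropyTerm).sum := by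
  rw [Polynomial.roots_mul (mul_ne_zero (pow_ne_zero _ Polynomial.X_ne_zero) hP)]
  simp [entropyTerm, Multiset.map_nsmul, Multiset.sum_nsmul]

theorem avgState_eq_mul {n S : Type} [Fintype S] [DecidableEq S] (p : S → ℝ) (σ : S → n → ℂ) :
    avgState p σ =
      of (fun a i => σ i a) * (of fun i a => (p i : ℂ) * star (σ i a)) := by
  ext a b
  simp [avgState, Matrix.sum_apply, mul_apply, vecMulVec_apply]
  exact Finset.sum_congr rfl fun i _ => by ring

/-- The entropy of an average memory state is determined by the weighted Gram matrix. -/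
theorem memoryEntropy_eq_sum_roots {n S : Type} [Fintype n] [DecidableEq n] [Fintype S]
    [DecidableEq S] (p : S → ℝ) (σ : S → n → ℂ) :
    memoryEntropy p σ =
      ((of fun i j => (p i : ℂ) * (star (σ i) ⬝ᵥ σ j)).charpoly.roots.map entropyTerm).sum := by
  -- With the average state factored through `S`, the two orders of multiplication have
  -- characteristic polynomials that agree up to powers of `X`; the reversed product is the weighted
  -- Gram matrix.
  rw [memoryEntropy, vonNeumannEntropy_eq_sum_roots,
    ← sum_entropyTerm_roots_X_pow_mul (charpoly_monic _).ne_zero (Fintype.card S),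
    avgState_eq_mul, charpoly_mul_comm',
    sum_entropyTerm_roots_X_pow_mul (charpoly_monic _).ne_zero]
  congr 4
  ext i j
  simp [mul_apply, dotProduct, Finset.mul_sum, mul_assoc]

theorem memoryEntropy_congr_gram {n m S : Type} [Fintype n] [DecidableEq n] [Fintype m]
    [DecidableEq m] [Fintype S] (p : S → ℝ) (σ : S → n → ℂ) (τ : S → m → ℂ)
    (h : ∀ i j, star (σ i) ⬝ᵥ σ j = star (τ i) ⬝ᵥ τ j) :
    memoryEntropy p σ = memoryEntropy p τ := by
  classical
  simp only [memoryEntropy_eq_sum_roots, h]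

/-- With trace 1 and this determinant the eigenvalues are `t` and `1 - t`, so the determinant alone
fixes the entropy. -/
theorem sum_entropyTerm_roots_fin_two {M : Matrix (Fin 2) (Fin 2) ℂ} {t : ℝ} (htr : M.trace = 1)
    (hdet : M.det = ((t * (1 - t) : ℝ) : ℂ)) :
    (M.charpoly.roots.map entropyTerm).sum = Real.binEntropy t / Real.log 2 := by
  have h : M.charpoly =
      (Polynomial.X - Polynomial.C (t : ℂ)) * (Polynomial.X - Polynomial.C ((1 - t : ℝ) : ℂ)) := by
    rw [charpoly_fin_two, htr, hdet]
    push_cast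
    simp only [map_mul, map_sub, map_one]
    ring
  rw [h, Polynomial.roots_mul (mul_ne_zero (Polynomial.X_sub_C_ne_zero _)
    (Polynomial.X_sub_C_ne_zero _))]
  simp only [Polynomial.roots_X_sub_C, Multiset.map_add, Multiset.map_singleton, Multiset.sum_add,
    Multiset.sum_singleton, entropyTerm, Complex.ofReal_re]
  rw [Real.binEntropy_eq_negMulLog_add_negMulLog_one_sub, add_div]

open scoped ComplexOrder in
theorem avgState_posSemidef {n S : Type} [Fintype n] [Fintype S] {p : S → ℝ} (hp : ∀ i, 0 ≤ p i)
    (σ : S → n → ℂ) : (avgState p σ).PosSemidef := by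
  classical
  refine posSemidef_sum _ fun i _ => ?_
  exact (posSemidef_vecMulVec_self_star (σ i)).smul (by exact_mod_cast hp i)

theorem memoryEntropy_nonneg {n S : Type} [Fintype n] [DecidableEq n] [Fintype S] {p : S → ℝ}
    (hp : ∀ i, 0 ≤ p i) (hp1 : ∑ i, p i = 1) {σ : S → n → ℂ}
    (hσ : ∀ i, ∑ a, ‖σ i a‖ ^ 2 = 1) : 0 ≤ memoryEntropy p σ := by
  have hpos := (avgState_posSemidef hp σ).eigenvalues_nonneg
  have htr : ∑ k, (avgState_isHermitian p σ).eigenvalues k = 1 := by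
    have h1 := (avgState_isHermitian p σ).trace_eq_sum_eigenvalues
    have h2 : (avgState p σ).trace = ((∑ i, p i : ℝ) : ℂ) := by
      simp only [avgState, trace_sum, trace_smul, trace_vecMulVec, Complex.ofReal_sum]
      refine Finset.sum_congr rfl fun i _ => ?_
      have : σ i ⬝ᵥ star (σ i) = 1 := by
        have := congrArg (fun r : ℝ => (r : ℂ)) (hσ i)
        simpa [dotProduct, Complex.mul_conj'] using this
      simp [this]
    rw [h2, hp1] at h1
    apply Complex.ofReal_injective
    rw [Complex.ofReal_sum, Complex.ofReal_one, ← Complex.ofReal_one, h1]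
    rfl
  refine Finset.sum_nonneg fun k _ => div_nonneg (Real.negMulLog_nonneg (hpos k) ?_)
    (Real.log_nonneg (by norm_num))
  rw [← htr]
  exact Finset.single_le_sum (fun k _ => hpos k) (Finset.mem_univ k)

/-! ### Quantum models as overlap conditions. -/

section Encoding

variable {X Y S : Type} [Fintype X] [Fintype Y] [Fintype S]

theorem star_tensor_dotProduct_tensor {n K : Type} [Fintype n] [Fintype K] (u u' : n → ℂ)
    (v v' : X → ℂ) (w w' : Y → ℂ) (t t' : K → ℂ) :
    star (tensor u v w t) ⬝ᵥ tensor u' v' w' t' =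
      (star u ⬝ᵥ u') * (star v ⬝ᵥ v') * (star w ⬝ᵥ w') * (star t ⬝ᵥ t') := by
  have key : ∀ {α β : Type} [Fintype α] [Fintype β] (f : α → ℂ) (g : β → ℂ),
      (∑ a, f a) * ∑ b, g b = ∑ c : α × β, f c.1 * g c.2 := fun f g => by
    rw [Fintype.sum_mul_sum, Fintype.sum_prod_type]
  simp only [dotProduct, tensor, Pi.star_apply, star_mul', mul_assoc]
  rw [key, key, key]
  exact Finset.sum_congr rfl fun a _ => by ring

theorem star_dotProduct_self_eq_one_iff {n : Type*} [Fintype n] (u : n → ℂ) :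
    star u ⬝ᵥ u = 1 ↔ ∑ a, ‖u a‖ ^ 2 = 1 := by
  simp only [dotProduct, Pi.star_apply, RCLike.star_def, Complex.conj_mul']
  norm_cast

/-- The inner product of the states into which an ideal evolution maps the encodings of `i` and `j`
on input `x`. -/
noncomputable def evolvedOverlap (A : Transducer X Y S) {n K : Type} [Fintype n] [Fintype K]
    (σ : S → n → ℂ) (ψ : S → X → Y → K → ℂ) (x : X) (i j : S) : ℂ :=
  ∑ y, ∑ k, ∑ l, ((Real.sqrt (A.mat x y i k) * Real.sqrt (A.mat x y j l) : ℝ) : ℂ) *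
    (star (σ k) ⬝ᵥ σ l) * (star (ψ i x y) ⬝ᵥ ψ j x y)

/-- Both tapes are in basis states: different inputs are orthogonal, and for equal inputs only equal
outputs interfere. -/
theorem star_evolved_dotProduct_evolved [DecidableEq X] [DecidableEq Y] (A : Transducer X Y S)
    {n K : Type} [Fintype n] [Fintype K] (σ : S → n → ℂ) (ψ : S → X → Y → K → ℂ) (x x' : X)
    (i j : S) :
    star (∑ y, ∑ k, (Real.sqrt (A.mat x y i k) : ℂ) •
        tensor (σ k) (Pi.single x (1 : ℂ)) (Pi.single y 1) (ψ i x y)) ⬝ᵥ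
      (∑ y, ∑ k, (Real.sqrt (A.mat x' y j k) : ℂ) •
        tensor (σ k) (Pi.single x' 1) (Pi.single y 1) (ψ j x' y)) =
      if x = x' then evolvedOverlap A σ ψ x i j else 0 := by
  simp only [star_sum, sum_dotProduct, dotProduct_sum, star_smul, smul_dotProduct, dotProduct_smul,
    star_tensor_dotProduct_tensor]
  have hs : ∀ {α : Type} [Fintype α] [DecidableEq α] (a b : α),
      star (Pi.single a (1 : ℂ)) ⬝ᵥ Pi.single b (1 : ℂ) = if a = b then 1 else 0 :=
    fun a b => by simp [Pi.single_apply, eq_comm]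
  simp only [hs]
  by_cases hx : x = x'
  · subst hx
    simp only [↓reduceIte, evolvedOverlap]
    refine Finset.sum_congr rfl fun y _ => ?_
    rw [Finset.sum_comm (s := Finset.univ (α := S))]
    refine Finset.sum_congr rfl fun l _ => ?_
    rw [Finset.sum_comm, Finset.smul_sum]
    refine Finset.sum_congr rfl fun k _ => ?_
    simp
    ring
  · simp [hx]

/-- A unitary evolution of a quantum model exists as soon as it preserves inner products. -/
theorem isQuantumEncoding_of_overlap [DecidableEq X] [DecidableEq Y] [Nonempty Y]
    (A : Transducer X Y S) {n K : Type} [Fintype n] [DecidableEq n] [Fintype K] [DecidableEq K]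
    [Nonempty K] (σ : S → n → ℂ) (ψ : S → X → Y → K → ℂ) (hσ : ∀ i, star (σ i) ⬝ᵥ σ i = 1)
    (hψ : ∀ i x y, star (ψ i x y) ⬝ᵥ ψ i x y = 1)
    (h : ∀ x i j, star (σ i) ⬝ᵥ σ j = evolvedOverlap A σ ψ x i j) : IsQuantumEncoding A σ := by
  classical
  obtain ⟨y₀⟩ := ‹Nonempty Y›
  obtain ⟨k₀⟩ := ‹Nonempty K›
  obtain ⟨U, hU⟩ := exists_unitary_mulVec
    (fun a : S × X => tensor (σ a.1) (Pi.single a.2 (1 : ℂ)) (Pi.single y₀ (1 : ℂ))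
      (Pi.single k₀ (1 : ℂ)))
    (fun a => ∑ y, ∑ j, (Real.sqrt (A.mat a.2 y a.1 j) : ℂ) •
        tensor (σ j) (Pi.single a.2 1) (Pi.single y 1) (ψ a.1 a.2 y))
    (fun a b => by
      rw [star_evolved_dotProduct_evolved, star_tensor_dotProduct_tensor, ← h]
      by_cases hx : a.2 = b.2 <;> simp [hx])
  exact ⟨K, inferInstance, inferInstance,
    { state := σ
      state_unit := fun i => (star_dotProduct_self_eq_one_iff _).1 (hσ i)
      blankOutput := y₀
      blankAncilla := k₀
      junk := ψ
      junk_unit := fun i x y => (star_dotProduct_self_eq_one_iff _).1 (hψ i x y)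
      U := U
      evolution := fun i x => hU (i, x) }, rfl⟩

/-- The necessary condition that unitarity imposes on every model; it is the source of the lower
bound on the cost. -/
theorem QuantumModel.overlap_eq [DecidableEq X] [DecidableEq Y] {A : Transducer X Y S} {n K : Type}
    [Fintype n] [DecidableEq n] [Fintype K] [DecidableEq K] (Q : QuantumModel A n K) (x : X)
    (i j : S) :
    star (Q.state i) ⬝ᵥ Q.state j = evolvedOverlap A Q.state Q.junk x i j := by
  have h := star_evolved_dotProduct_evolved A Q.state Q.junk x x i j
  rw [if_pos rfl, ← Q.evolution, ← Q.evolution, star_mulVec, ← dotProduct_mulVec, mulVec_mulVec,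
    ← star_eq_conjTranspose, mem_unitaryGroup_iff'.1 Q.U.2, one_mulVec,
    star_tensor_dotProduct_tensor] at h
  simpa [← Pi.single_star] using h

theorem norm_star_dotProduct_le_one {n : Type*} [Fintype n] {u v : n → ℂ} (hu : star u ⬝ᵥ u = 1)
    (hv : star v ⬝ᵥ v = 1) : ‖star u ⬝ᵥ v‖ ≤ 1 := by
  have h := norm_inner_le_norm (𝕜 := ℂ) (WithLp.toLp 2 u : EuclideanSpace ℂ n) (WithLp.toLp 2 v)
  rw [EuclideanSpace.norm_eq, EuclideanSpace.norm_eq] at h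
  simp only [(star_dotProduct_self_eq_one_iff _).1 hu, (star_dotProduct_self_eq_one_iff _).1 hv] at h
  simpa [EuclideanSpace.inner_eq_star_dotProduct, dotProduct_comm] using h

end Encoding

/-! ### Driven transducers: lumping, stationary laws and causal states. -/

section General

variable {X Y : Type} [Fintype X]

theorem sumInputs_sum {ι : Type*} (s : Finset ι) (g : ι → List (X × Y) → ℝ) (v : List Y) :
    sumInputs (fun w => ∑ a ∈ s, g a w) v = ∑ a ∈ s, sumInputs (g a) v := by
  induction v generalizing g with
  | nil => rfl
  | cons y v ih =>
    simp only [sumInputs, ih]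
    exact Finset.sum_comm

theorem sumInputs_const_mul (c : ℝ) (g : List (X × Y) → ℝ) (v : List Y) :
    sumInputs (fun w => c * g w) v = c * sumInputs g v := by
  induction v generalizing g with
  | nil => rfl
  | cons y v ih => simp only [sumInputs, ih, Finset.mul_sum]

/-- The outputs of a transducer driven by a hidden Markov model `M` are generated by a hidden Markov
model `N` onto which the relevant joint states, indexed by `P`, can be lumped. -/
theorem sumInputs_wordProb_mul_wordProb {S R Q P : Type} [Fintype Y] [Fintype S] [Fintype R]
    [Fintype Q] [Fintype P] [DecidableEq S] [DecidableEq R] [DecidableEq Q]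
    (M : HMM X R) (A : Transducer X Y S) (N : HMM Y Q) (r : P → R) (s : P → S) (q : P → Q)
    (m : Y → P → P → ℝ)
    (joint : ∀ y c t k, ∑ x, M.mat x (r c) t * A.mat x y (s c) k =
      ∑ c', if r c' = t ∧ s c' = k then m y c c' else 0)
    (lump : ∀ y c k, ∑ c', (if q c' = k then m y c c' else 0) = N.mat y (q c) k)
    (v : List Y) (c : P) :
    sumInputs (fun w => M.wordProb (r c) (w.map Prod.fst) * A.wordProb (s c) w) v =
      N.wordProb (q c) v := by
  induction v generalizing c with
  | nil => simp [sumInputs, HMM.wordProb, Transducer.wordProb]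
  | cons y v ih =>
    have expand : ∀ x, sumInputs (fun w : List (X × Y) =>
        M.wordProb (r c) (((x, y) :: w).map Prod.fst) * A.wordProb (s c) ((x, y) :: w)) v =
        ∑ t, ∑ k, M.mat x (r c) t * A.mat x y (s c) k *
          sumInputs (fun w => M.wordProb t (w.map Prod.fst) * A.wordProb k w) v := by
      intro x
      simp only [← sumInputs_const_mul, ← sumInputs_sum]
      congr 1
      funext w
      simp only [List.map_cons, HMM.wordProb, Transducer.wordProb, Finset.sum_mul_sum]
      exact Finset.sum_congr rfl fun t _ => Finset.sum_congr rfl fun k _ => by ring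
    -- By `joint`, the only joint states reached are the pairs `(r c', s c')`, and there the
    -- induction hypothesis applies.
    have collapse : ∀ c', ∑ t, ∑ k, (if r c' = t ∧ s c' = k then m y c c' else 0) *
        sumInputs (fun w => M.wordProb t (w.map Prod.fst) * A.wordProb k w) v =
        m y c c' * N.wordProb (q c') v := fun c' => by
      simp only [ite_and, ite_mul, zero_mul, ← ih]
      rw [Finset.sum_eq_single (r c') (fun t _ ht => by simp [ht.symm]) (by simp),
        Finset.sum_eq_single (s c') (fun k _ hk => by simp [hk.symm]) (by simp)]
      simp
    calc sumInputs (fun w => M.wordProb (r c) (w.map Prod.fst) * A.wordProb (s c) w) (y :: v)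
        = ∑ x, ∑ t, ∑ k, M.mat x (r c) t * A.mat x y (s c) k *
          sumInputs (fun w => M.wordProb t (w.map Prod.fst) * A.wordProb k w) v :=
          Finset.sum_congr rfl fun x _ => expand x
      _ = ∑ t, ∑ k, ∑ x, M.mat x (r c) t * A.mat x y (s c) k *
          sumInputs (fun w => M.wordProb t (w.map Prod.fst) * A.wordProb k w) v := by
          rw [Finset.sum_comm]
          exact Finset.sum_congr rfl fun t _ => Finset.sum_comm
      _ = ∑ t, ∑ k, ∑ c', (if r c' = t ∧ s c' = k then m y c c' else 0) *
          sumInputs (fun w => M.wordProb t (w.map Prod.fst) * A.wordProb k w) v := by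
          simp only [← Finset.sum_mul, joint]
      _ = ∑ c', ∑ t, ∑ k, (if r c' = t ∧ s c' = k then m y c c' else 0) *
          sumInputs (fun w => M.wordProb t (w.map Prod.fst) * A.wordProb k w) v := by
          conv_rhs => rw [Finset.sum_comm]
          exact Finset.sum_congr rfl fun t _ => Finset.sum_comm
      _ = ∑ c', m y c c' * N.wordProb (q c') v := Finset.sum_congr rfl fun c' _ => collapse c'
      _ = ∑ c', ∑ k, (if q c' = k then m y c c' else 0) * N.wordProb k v := by
          simp only [ite_mul, zero_mul, Finset.sum_ite_eq, Finset.mem_univ, if_true]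
      _ = ∑ k, ∑ c', (if q c' = k then m y c c' else 0) * N.wordProb k v := Finset.sum_comm
      _ = N.wordProb (q c) (y :: v) := by simp only [← Finset.sum_mul, lump, HMM.wordProb]

theorem StationaryProcess.prob_le_one (I : StationaryProcess X) (w : List X) : I.prob w ≤ 1 := by
  induction w with
  | nil => exact I.nil.le
  | cons x w ih =>
    refine le_trans ?_ ih
    rw [← I.sum_cons w]
    exact Finset.single_le_sum (f := fun x => I.prob (x :: w)) (fun x _ => I.nonneg _)
      (Finset.mem_univ x)

variable {S : Type} [Fintype Y] [Fintype S]

theorem Transducer.IsStationaryLaw.le_one {A : Transducer X Y S} {I : StationaryProcess X}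
    {V : S → List X → ℝ} (hV : A.IsStationaryLaw I V) (i : S) (w : List X) : V i w ≤ 1 := by
  refine le_trans ?_ (I.prob_le_one w)
  rw [← hV.input w]
  exact Finset.single_le_sum (f := fun i => V i w) (fun i _ => hV.nonneg i w) (Finset.mem_univ i)

/-- The last input-output pair already reveals the state. Constant pasts along self-loops reach
every state, so only the separation of future morphs remains to be assumed. -/
theorem Transducer.isEpsilonTransducer_of_separating {A : Transducer X Y S} (next : X → Y → S)
    (hnext : ∀ x y i j, 0 < A.mat x y i j → j = next x y) (self : S → X × Y)
    (hself : ∀ i, 0 < A.mat (self i).1 (self i).2 i i)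
    (separating : ∀ i j, (∀ w, A.wordProb i w = A.wordProb j w) → i = j) :
    A.IsEpsilonTransducer fun z => next (z 0).1 (z 0).2 where
  unifilar x y i j j' h h' := (hnext x y i j h).trans (hnext x y i j' h').symm
  encodes z s h := hnext _ _ _ _ (h 0)
  onto i := ⟨fun _ => self i, fun _ => i, fun _ => hself i, rfl⟩
  causal z z' _ _ := ⟨fun h w => by rw [h], separating _ _⟩

end General

/-! ### The two channels: causal states, stationary laws, outputs. -/

theorem agentA_mat :
    agentA.mat 0 0 = !![1, 0, 0; 1, 0, 0; 1, 0, 0] ∧ agentA.mat 0 1 = 0 ∧ agentA.mat 0 2 = 0 ∧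
    agentA.mat 1 0 = 0 ∧ agentA.mat 1 1 = !![0, 0, 0; 0, 1 / 3, 0; 0, 1 / 4, 0] ∧
    agentA.mat 1 2 = !![0, 0, 1 - 0; 0, 0, 1 - 1 / 3; 0, 0, 1 - 1 / 4] ∧
    agentA.mat 2 0 = 0 ∧ agentA.mat 2 1 = 0 ∧ agentA.mat 2 2 = !![0, 0, 1; 0, 0, 1; 0, 0, 1] :=
  ⟨rfl, rfl, rfl, rfl, rfl, rfl, rfl, rfl, rfl⟩

theorem agentAInv_mat :
    agentAInv.mat 0 0 = !![1, 0; 1, 0] ∧ agentAInv.mat 0 1 = 0 ∧ agentAInv.mat 0 2 = 0 ∧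
    agentAInv.mat 1 0 = 0 ∧ agentAInv.mat 1 1 = !![0, 1; 0, 1] ∧ agentAInv.mat 1 2 = 0 ∧
    agentAInv.mat 2 0 = 0 ∧ agentAInv.mat 2 1 = !![0, 1 / 2; 0, 1] ∧
    agentAInv.mat 2 2 = !![0, 1 / 2; 0, 0] := by
  refine ⟨rfl, rfl, rfl, rfl, rfl, rfl, rfl, ?_, ?_⟩
  · change !![0, (1 - 0) / (2 - 0); 0, 1] = _
    norm_num
  · change !![0, 1 / (2 - 0); 0, 0] = _
    norm_num

theorem inputHMM_mat :
    inputHMM.mat 0 = !![0, 0; 1 / 2, 0] ∧ inputHMM.mat 1 = !![0, 1 / 2; 0, 1 / 2] ∧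
    inputHMM.mat 2 = !![0, 1 / 2; 0, 0] :=
  ⟨rfl, rfl, rfl⟩

theorem agentA_isEpsilonTransducer : ∃ ε, agentA.IsEpsilonTransducer ε := by
  refine ⟨_, Transducer.isEpsilonTransducer_of_separating (fun _ y => y) ?_ (fun i => (i, i)) ?_ ?_⟩
  · simp [Fin.forall_fin_succ, agentA_mat]
  · simp [Fin.forall_fin_succ, agentA_mat]
  · intro i j h
    -- This word has probabilities 0, 1/3 and 1/4 from the three states.
    specialize h [(1, 1)]
    revert h
    revert i j
    simp [Fin.forall_fin_succ, agentA_mat, Transducer.wordProb, Fin.sum_univ_three]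

theorem agentAInv_isEpsilonTransducer : ∃ ε, agentAInv.IsEpsilonTransducer ε := by
  refine ⟨_, Transducer.isEpsilonTransducer_of_separating (fun x _ => ![0, 1, 1] x) ?_
    ![(0, 0), (1, 1)] ?_ ?_⟩
  · simp [Fin.forall_fin_succ, agentAInv_mat]
  · simp [Fin.forall_fin_succ, agentAInv_mat]
  · intro i j h
    -- This word has probability 1/2 from `φ₀` and 1 from `φ₁`.
    specialize h [(2, 1)]
    revert h
    revert i j
    simp [Fin.forall_fin_succ, agentAInv_mat, Transducer.wordProb]

/-- The Markov chain of the outputs of `agentA` driven by `inputProcess`; its state is the last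
output. -/
noncomputable def outputHMM : HMM (Fin 3) (Fin 3) where
  mat := ![!![0, 0, 0; 1 / 2, 0, 0; 1 / 2, 0, 0], !![0, 0, 0; 0, 1 / 6, 0; 0, 1 / 8, 0],
    !![0, 0, 1; 0, 0, 1 / 3; 0, 0, 3 / 8]]
  nonneg := by
    simp [Fin.forall_fin_succ]
    norm_num
  sum_one i := by
    fin_cases i <;> simp [Fin.sum_univ_three] <;> norm_num

theorem outputHMM_mat :
    outputHMM.mat 0 = !![0, 0, 0; 1 / 2, 0, 0; 1 / 2, 0, 0] ∧
    outputHMM.mat 1 = !![0, 0, 0; 0, 1 / 6, 0; 0, 1 / 8, 0] ∧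
    outputHMM.mat 2 = !![0, 0, 1; 0, 0, 1 / 3; 0, 0, 3 / 8] :=
  ⟨rfl, rfl, rfl⟩

/-- The stationary distribution of the states of `agentA` driven by `inputProcess`. -/
noncomputable def agentDist : Fin 3 → ℝ := ![1 / 3, 2 / 23, 40 / 69]

theorem agentDist_nonneg (i : Fin 3) : 0 ≤ agentDist i := by
  fin_cases i <;> norm_num [agentDist]

noncomputable def outputProcess : StationaryProcess (Fin 3) :=
  outputHMM.process agentDist agentDist_nonneg
    (by simp [agentDist, Fin.sum_univ_three]; norm_num)
    (fun j => by
      fin_cases j <;> simp [agentDist, outputHMM, Fin.sum_univ_three] <;> norm_num)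

/-- The state of `inputHMM`, and of `agentAInv`, that goes with a state of `agentA`. -/
def coarseState : Fin 3 → Fin 2 := ![0, 1, 1]

/-- The state fixes the state of the input generator, so the future inputs are those of `inputHMM`
started in `coarseState i`. -/
noncomputable def agentLaw (i : Fin 3) (w : List (Fin 3)) : ℝ :=
  agentDist i * inputHMM.wordProb (coarseState i) w

noncomputable def inverseLaw : Fin 2 → List (Fin 3) → ℝ :=
  ![fun w => agentDist 0 * outputHMM.wordProb 0 w,
    fun w => agentDist 1 * outputHMM.wordProb 1 w + agentDist 2 * outputHMM.wordProb 2 w]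

theorem agentLaw_isStationaryLaw : agentA.IsStationaryLaw inputProcess agentLaw where
  nonneg i w := mul_nonneg (agentDist_nonneg i) (inputHMM.wordProb_nonneg _ w)
  input w := by
    simp [agentLaw, agentDist, coarseState, inputProcess, HMM.process, Fin.sum_univ_three]
    ring
  consistent i w := by simp only [agentLaw, ← Finset.mul_sum, HMM.sum_wordProb_append]
  stationary j w := by
    fin_cases j <;>
      simp [agentLaw, agentDist, coarseState, HMM.wordProb, inputHMM_mat, agentA_mat,
        Fin.sum_univ_three] <;> ring

theorem inverseLaw_isStationaryLaw : agentAInv.IsStationaryLaw outputProcess inverseLaw where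
  nonneg i w := by
    have h i := mul_nonneg (agentDist_nonneg i) (outputHMM.wordProb_nonneg i w)
    fin_cases i
    · exact h 0
    · exact add_nonneg (h 1) (h 2)
  input w := by
    simp [inverseLaw, outputProcess, HMM.process, Fin.sum_univ_three]
    ring
  consistent i w := by
    fin_cases i <;>
      simp [inverseLaw, ← Finset.mul_sum, HMM.sum_wordProb_append, Finset.sum_add_distrib]
  stationary j w := by
    fin_cases j <;>
      simp [inverseLaw, agentDist, HMM.wordProb, outputHMM_mat, agentAInv_mat,
        Fin.sum_univ_three] <;> ring

/-- State 0 is entered exactly on input 0, so its weight is read off the input process. The weight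
of state 1 obeys a contracting recursion, and the total fixes that of state 2. -/
theorem agentA_isStationaryLaw_unique {I : StationaryProcess (Fin 3)}
    {V V' : Fin 3 → List (Fin 3) → ℝ} (hV : agentA.IsStationaryLaw I V)
    (hV' : agentA.IsStationaryLaw I V') : V' = V := by
  have rec0 : ∀ {V}, agentA.IsStationaryLaw I V → ∀ w, V 0 w = I.prob (0 :: w) := fun h w => by
    rw [h.stationary, ← h.input]
    simp [agentA_mat, Fin.sum_univ_three]
  -- The factor is `1 / 12 = q - r = 1 / 3 - 1 / 4`, after the weight of state 2 has been eliminated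
  -- through the input marginal.
  have rec1 : ∀ {V}, agentA.IsStationaryLaw I V → ∀ w, V 1 w =
      1 / 12 * V 1 (1 :: w) + 1 / 4 * (I.prob (1 :: w) - I.prob (0 :: 1 :: w)) := fun h w => by
    rw [h.stationary, ← h.input (1 :: w), ← rec0 h (1 :: w)]
    simp [agentA_mat, Fin.sum_univ_three]
    ring
  have bound : ∀ (n : ℕ) w, |V' 1 w - V 1 w| ≤ (1 / 12) ^ n := by
    intro n
    induction n with
    | zero =>
      intro w
      rw [pow_zero, abs_le]
      constructor <;>
        linarith [hV.nonneg 1 w, hV'.nonneg 1 w, hV.le_one 1 w, hV'.le_one 1 w]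
    | succ n ih =>
      intro w
      have h : V' 1 w - V 1 w = 1 / 12 * (V' 1 (1 :: w) - V 1 (1 :: w)) := by
        rw [rec1 hV, rec1 hV']
        ring
      rw [h, abs_mul, pow_succ']
      exact mul_le_mul (by norm_num) (ih _) (abs_nonneg _) (by norm_num)
  have h1 : ∀ w, V' 1 w = V 1 w := fun w => by
    have := ge_of_tendsto' (tendsto_pow_atTop_nhds_zero_of_lt_one (r := (1 / 12 : ℝ))
      (by norm_num) (by norm_num)) fun n => bound n w
    exact sub_eq_zero.1 (abs_nonpos_iff.1 this)
  have h0 : ∀ w, V' 0 w = V 0 w := fun w => by rw [rec0 hV, rec0 hV']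
  funext i w
  fin_cases i
  · exact h0 w
  · exact h1 w
  · have := (hV.input w).trans (hV'.input w).symm
    rw [Fin.sum_univ_three, Fin.sum_univ_three, h0, h1] at this
    exact (add_left_cancel this).symm

/-- The next state is a function of the input alone, so stationarity expresses the law through `I`.
-/
theorem agentAInv_isStationaryLaw_unique {I : StationaryProcess (Fin 3)}
    {W W' : Fin 2 → List (Fin 3) → ℝ} (hW : agentAInv.IsStationaryLaw I W)
    (hW' : agentAInv.IsStationaryLaw I W') : W' = W := by
  have h : ∀ {W}, agentAInv.IsStationaryLaw I W → ∀ i w,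
      W i w = ![I.prob (0 :: w), I.prob (1 :: w) + I.prob (2 :: w)] i := fun h i w => by
    rw [h.stationary, ← h.input, ← h.input, ← h.input]
    fin_cases i <;> simp [agentAInv_mat, Fin.sum_univ_three]
    ring
  funext i w
  rw [h hW, h hW']

theorem agentA_maps : agentA.Maps inputProcess agentLaw outputProcess where
  law := agentLaw_isStationaryLaw
  unique _ h := agentA_isStationaryLaw_unique agentLaw_isStationaryLaw h
  output v := by
    have h := sumInputs_wordProb_mul_wordProb inputHMM agentA outputHMM coarseState
      (fun i => i) (fun i => i)
      outputHMM.mat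
      (by
        simp [Fin.forall_fin_succ, Fin.sum_univ_three, inputHMM_mat, outputHMM_mat, agentA_mat,
          coarseState]
        norm_num)
      (by simp) v
    have e : agentA.jointProb agentLaw = fun w => ∑ i, agentDist i *
        (inputHMM.wordProb (coarseState i) (w.map Prod.fst) * agentA.wordProb i w) := by
      funext w
      simp only [Transducer.jointProb, agentLaw, mul_assoc]
    rw [e, sumInputs_sum]
    simp only [sumInputs_const_mul]
    simp only [h]
    rfl

theorem agentAInv_maps : agentAInv.Maps outputProcess inverseLaw inputProcess where
  law := inverseLaw_isStationaryLaw
  unique _ h := agentAInv_isStationaryLaw_unique inverseLaw_isStationaryLaw h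
  output v := by
    -- States 1 and 2 of `outputHMM` may be merged: they differ only in how they split probability
    -- 1/2 between the outputs 1 and 2, and from `φ₁` the inverse turns both of these into 1.
    have h := sumInputs_wordProb_mul_wordProb outputHMM agentAInv inputHMM (fun i => i)
      coarseState coarseState
      (fun y c c' => ∑ x, outputHMM.mat x c c' * agentAInv.mat x y (coarseState c) (coarseState c'))
      (by simp [Fin.forall_fin_succ, Fin.sum_univ_three, outputHMM_mat, agentAInv_mat, coarseState])
      (by
        simp [Fin.forall_fin_succ, Fin.sum_univ_three, inputHMM_mat, outputHMM_mat, agentAInv_mat,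
          coarseState]
        norm_num) v
    have e : agentAInv.jointProb inverseLaw = fun w => ∑ i, agentDist i *
        (outputHMM.wordProb i (w.map Prod.fst) * agentAInv.wordProb (coarseState i) w) := by
      funext w
      simp [Transducer.jointProb, inverseLaw, coarseState, Fin.sum_univ_three]
      ring
    rw [e, sumInputs_sum]
    simp only [sumInputs_const_mul]
    simp only [h]
    simp [inputProcess, HMM.process, Fin.sum_univ_three, agentDist, coarseState]
    ring

theorem stateDist_agentLaw : stateDist agentLaw = agentDist := by
  funext i
  simp [stateDist, agentLaw, HMM.wordProb]

theorem stateDist_inverseLaw : stateDist inverseLaw = ![1 / 3, 2 / 3] := by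
  funext i
  fin_cases i <;> simp [stateDist, inverseLaw, HMM.wordProb, agentDist]
  norm_num

/-! ### The product encoding as a quantum model. -/

section ProductEncoding

variable {X Y S : Type} [Fintype X] [Fintype Y] [Fintype S]

theorem star_prod_dotProduct_prod [DecidableEq X] {C : Type} [Fintype C] (a b : X → C → ℝ) :
    star (fun f : X → C => ∏ x, (a x (f x) : ℂ)) ⬝ᵥ (fun f => ∏ x, (b x (f x) : ℂ)) =
      ((∏ x, ∑ c, a x c * b x c : ℝ) : ℂ) := by
  rw [Finset.prod_univ_sum]
  simp only [Fintype.piFinset_univ, dotProduct, Pi.star_apply, star_prod, ← Finset.prod_mul_distrib]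
  push_cast
  simp

/-- The overlap of the factors of two product encodings that belong to the input `x`. -/
noncomputable def inputOverlap (A : Transducer X Y S) (x : X) (i j : S) : ℝ :=
  ∑ y, ∑ k, Real.sqrt (A.mat x y i k) * Real.sqrt (A.mat x y j k)

theorem inputOverlap_self (A : Transducer X Y S) (x : X) (i : S) : inputOverlap A x i i = 1 := by
  simp only [inputOverlap, Real.mul_self_sqrt (A.nonneg _ _ _ _), A.sum_one]

theorem star_productEncoding_dotProduct [DecidableEq X] (A : Transducer X Y S) (i j : S) :
    star (productEncoding A i) ⬝ᵥ productEncoding A j = ((∏ x, inputOverlap A x i j : ℝ) : ℂ) := by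
  rw [show star (productEncoding A i) ⬝ᵥ productEncoding A j = _ from
    star_prod_dotProduct_prod (fun x (c : Y × S) => Real.sqrt (A.mat x c.1 i c.2))
      (fun x c => Real.sqrt (A.mat x c.1 j c.2))]
  simp only [inputOverlap, Fintype.sum_prod_type]

/-- The product encoding is realized by a quantum model if the next state of the transducer is a
function of its input and output. -/
theorem isQuantumEncoding_productEncoding [DecidableEq X] [DecidableEq Y] [DecidableEq S]
    [Nonempty Y] [Nonempty S] (A : Transducer X Y S) (next : X → Y → S)
    (hnext : ∀ x y i j, j ≠ next x y → A.mat x y i j = 0) :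
    IsQuantumEncoding A (productEncoding A) := by
  obtain ⟨c₀⟩ := (inferInstance : Nonempty (Y × S))
  -- The junk keeps the factors of the inputs other than `x` and replaces the factor at `x` by a
  -- fixed basis vector: that factor is used up in producing the output and the next state.
  let factor (i : S) (x : X) : X → Y × S → ℝ :=
    Function.update (fun x' c => Real.sqrt (A.mat x' c.1 i c.2)) x (Pi.single c₀ 1)
  let ψ (i : S) (x : X) (_ : Y) (f : X → Y × S) : ℂ := ∏ x', (factor i x x' (f x') : ℂ)
  have hψ : ∀ i j x y, star (ψ i x y) ⬝ᵥ ψ j x y =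
      ((∏ x' ∈ Finset.univ.erase x, inputOverlap A x' i j : ℝ) : ℂ) := fun i j x y => by
    rw [show star (ψ i x y) ⬝ᵥ ψ j x y = _ from
      star_prod_dotProduct_prod (factor i x) (factor j x),
      ← Finset.mul_prod_erase Finset.univ _ (Finset.mem_univ x)]
    congr 1
    rw [show ∑ c, factor i x x c * factor j x x c = 1 by simp [factor, Pi.single_apply], one_mul]
    refine Finset.prod_congr rfl fun x' hx' => ?_
    simp [factor, Function.update_of_ne (Finset.ne_of_mem_erase hx'), inputOverlap,
      Fintype.sum_prod_type]
  have self : ∀ i, star (productEncoding A i) ⬝ᵥ productEncoding A i = 1 := fun i => by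
    simp [star_productEncoding_dotProduct, inputOverlap_self]
  refine isQuantumEncoding_of_overlap A _ ψ self (fun i x y => ?_) fun x i j => ?_
  · simp [hψ, inputOverlap_self]
  -- Given `x` and `y`, both branches end in the same state `next x y`, whose overlap with itself is
  -- 1.
  · have collapse : ∀ y, ∑ k, ∑ l, ((Real.sqrt (A.mat x y i k) * Real.sqrt (A.mat x y j l) : ℝ) : ℂ) *
        (star (productEncoding A k) ⬝ᵥ productEncoding A l) * (star (ψ i x y) ⬝ᵥ ψ j x y) =
        ((∑ k, Real.sqrt (A.mat x y i k) * Real.sqrt (A.mat x y j k) : ℝ) : ℂ) *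
          (star (ψ i x y) ⬝ᵥ ψ j x y) := fun y => by
      rw [Finset.sum_eq_single (next x y) (fun k _ hk => by simp [hnext x y i k hk]) (by simp),
        Finset.sum_eq_single (next x y) (fun l _ hl => by simp [hnext x y j l hl]) (by simp),
        Finset.sum_eq_single (next x y) (fun k _ hk => by simp [hnext x y i k hk]) (by simp),
        self, mul_one]
    simp only [evolvedOverlap, collapse]
    simp only [hψ, ← Finset.sum_mul]
    rw [star_productEncoding_dotProduct, ← Finset.mul_prod_erase Finset.univ _ (Finset.mem_univ x)]
    push_cast [inputOverlap]
    rfl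

end ProductEncoding

theorem agentA_isQuantumEncoding : IsQuantumEncoding agentA (productEncoding agentA) :=
  isQuantumEncoding_productEncoding agentA (fun _ y => y)
    (by simp [Fin.forall_fin_succ, agentA_mat])

theorem agentAInv_isQuantumEncoding : IsQuantumEncoding agentAInv (productEncoding agentAInv) :=
  isQuantumEncoding_productEncoding agentAInv (fun x _ => ![0, 1, 1] x)
    (by simp [Fin.forall_fin_succ, agentAInv_mat])

/-! ### Overlaps and entropies of the two encodings. -/

/-- Real vectors of a plane with the same overlaps as the product encoding of `agentA`. -/
noncomputable def planeEncoding (i : Fin 3) : Fin 2 → ℂ :=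
  ![(Real.sqrt (![0, 1 / 3, 1 / 4] i) : ℂ), (Real.sqrt (![1, 2 / 3, 3 / 4] i) : ℂ)]

/-- Inputs 0 and 2 act alike from every state, so only the factor of input 1 distinguishes the
states. -/
theorem star_productEncoding_agentA_dotProduct (i j : Fin 3) :
    star (productEncoding agentA i) ⬝ᵥ productEncoding agentA j =
      star (planeEncoding i) ⬝ᵥ planeEncoding j := by
  have h0 : inputOverlap agentA 0 i j = 1 := by
    fin_cases i <;> fin_cases j <;> simp [inputOverlap, agentA_mat, Fin.sum_univ_three]
  have h2 : inputOverlap agentA 2 i j = 1 := by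
    fin_cases i <;> fin_cases j <;> simp [inputOverlap, agentA_mat, Fin.sum_univ_three]
  have h1 : inputOverlap agentA 1 i j =
      Real.sqrt (![0, 1 / 3, 1 / 4] i) * Real.sqrt (![0, 1 / 3, 1 / 4] j) +
      Real.sqrt (![1, 2 / 3, 3 / 4] i) * Real.sqrt (![1, 2 / 3, 3 / 4] j) := by
    have e1 : (1 - 3⁻¹ : ℝ) = 2 / 3 := by norm_num
    have e2 : (1 - 4⁻¹ : ℝ) = 3 / 4 := by norm_num
    fin_cases i <;> fin_cases j <;>
      simp [inputOverlap, agentA_mat, Fin.sum_univ_three, e1, e2]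
  rw [star_productEncoding_dotProduct, Fin.prod_univ_three, h0, h1, h2]
  simp [planeEncoding, dotProduct, Fin.sum_univ_two]

/-- The right side of `ht` is the determinant of the average state of `planeEncoding`, with
denominator `69 ^ 2`. -/
theorem memoryEntropy_productEncoding_agentA {t : ℝ}
    (ht : t * (1 - t) = (376 - 40 * Real.sqrt 6) / 4761) :
    memoryEntropy agentDist (productEncoding agentA) = Real.binEntropy t / Real.log 2 := by
  have s3 : Real.sqrt 3 * Real.sqrt 3 = 3 := Real.mul_self_sqrt (by norm_num)
  have s2 : Real.sqrt 2 * Real.sqrt 2 = 2 := Real.mul_self_sqrt (by norm_num)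
  have sq6 : Real.sqrt 2 * Real.sqrt 3 = Real.sqrt 6 := by
    rw [← Real.sqrt_mul (by norm_num)]
    norm_num
  have off : avgState agentDist planeEncoding =
      (!![4 / 23, (2 * Real.sqrt 2 + 10 * Real.sqrt 3) / 69;
        (2 * Real.sqrt 2 + 10 * Real.sqrt 3) / 69, 19 / 23] : Matrix (Fin 2) (Fin 2) ℝ).map
        Complex.ofReal := by
    have i3 : (Real.sqrt 3)⁻¹ = Real.sqrt 3 * 3⁻¹ :=
      inv_eq_of_mul_eq_one_right (by linear_combination 3⁻¹ * s3)
    have s4 : Real.sqrt 4 = 2 := by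
      rw [show (4 : ℝ) = 2 ^ 2 by norm_num, Real.sqrt_sq (by norm_num)]
    have e : ∀ a b, avgState agentDist planeEncoding a b =
        ((∑ i, agentDist i * (![Real.sqrt (![0, 1 / 3, 1 / 4] i),
            Real.sqrt (![1, 2 / 3, 3 / 4] i)] a * ![Real.sqrt (![0, 1 / 3, 1 / 4] i),
            Real.sqrt (![1, 2 / 3, 3 / 4] i)] b) : ℝ) : ℂ) := fun a b => by
      simp only [avgState, Matrix.sum_apply, Matrix.smul_apply, vecMulVec_apply, Pi.star_apply,
        Complex.ofReal_sum]
      refine Finset.sum_congr rfl fun i _ => ?_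
      fin_cases a <;> fin_cases b <;> simp [planeEncoding]
    ext a b
    rw [e, map_apply]
    congr 1
    fin_cases a <;> fin_cases b <;>
      simp [agentDist, Fin.sum_univ_three, s4] <;> simp only [div_eq_mul_inv, i3]
    · linear_combination 2 / 207 * s3
    · linear_combination 2 / 207 * Real.sqrt 2 * s3
    · linear_combination 2 / 207 * Real.sqrt 2 * s3
    · linear_combination 2 / 207 * (Real.sqrt 2 * Real.sqrt 2 * s3 + 3 * s2) + 10 / 69 * s3
  rw [memoryEntropy_congr_gram _ _ _ star_productEncoding_agentA_dotProduct, memoryEntropy,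
    vonNeumannEntropy_eq_sum_roots]
  refine sum_entropyTerm_roots_fin_two ?_ ?_
  · rw [off, trace_fin_two]
    simp
    norm_num
  · have hd : (!![4 / 23, (2 * Real.sqrt 2 + 10 * Real.sqrt 3) / 69;
        (2 * Real.sqrt 2 + 10 * Real.sqrt 3) / 69, 19 / 23] : Matrix (Fin 2) (Fin 2) ℝ).det =
        t * (1 - t) := by
      rw [ht, det_fin_two_of, ← sq6]
      linear_combination -4 / 4761 * s2 - 100 / 4761 * s3
    rw [off, ← hd]
    exact (RingHom.map_det Complex.ofRealHom _).symm

/-- The weighted Gram matrix has determinant `1/3 * 2/3` times one minus the squared overlap. -/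
theorem memoryEntropy_of_overlap {n : Type} [Fintype n] [DecidableEq n] {σ : Fin 2 → n → ℂ}
    (hσ : ∀ i, star (σ i) ⬝ᵥ σ i = 1) {t : ℝ}
    (ht : t * (1 - t) = 2 / 9 * (1 - ‖star (σ 0) ⬝ᵥ σ 1‖ ^ 2)) :
    memoryEntropy ![1 / 3, 2 / 3] σ = Real.binEntropy t / Real.log 2 := by
  rw [memoryEntropy_eq_sum_roots]
  refine sum_entropyTerm_roots_fin_two ?_ ?_
  · simp [trace_fin_two, hσ]
    norm_num
  · have hc : star (σ 1) ⬝ᵥ σ 0 = star (star (σ 0) ⬝ᵥ σ 1) := by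
      rw [star_dotProduct]
    have hn := Complex.mul_conj' (star (σ 0) ⬝ᵥ σ 1)
    rw [ht, det_fin_two]
    simp only [of_apply, hσ, hc, RCLike.star_def]
    push_cast
    rw [← hn]
    simp
    ring

/-- On input 2 the two states share only the output 1, with probabilities 1/2 and 1, and then both
move to `φ₁`. Their overlap is therefore `√(1/2)` times a junk overlap, which Cauchy–Schwarz bounds
by 1. -/
theorem QuantumModel.norm_overlap_sq_le {n K : Type} [Fintype n] [DecidableEq n] [Fintype K]
    [DecidableEq K] (Q : QuantumModel agentAInv n K) :
    ‖star (Q.state 0) ⬝ᵥ Q.state 1‖ ^ 2 ≤ 1 / 2 := by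
  have h1 : star (Q.state 1) ⬝ᵥ Q.state 1 = 1 :=
    (star_dotProduct_self_eq_one_iff _).2 (Q.state_unit 1)
  have h : star (Q.state 0) ⬝ᵥ Q.state 1 =
      (Real.sqrt (1 / 2) : ℂ) * (star (Q.junk 0 2 1) ⬝ᵥ Q.junk 1 2 1) := by
    rw [Q.overlap_eq 2]
    simp [evolvedOverlap, Fin.sum_univ_three, agentAInv_mat, h1]
  have hj := norm_star_dotProduct_le_one
    ((star_dotProduct_self_eq_one_iff _).2 (Q.junk_unit 0 2 1))
    ((star_dotProduct_self_eq_one_iff _).2 (Q.junk_unit 1 2 1))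
  rw [h, norm_mul, mul_pow, Complex.norm_real, Real.norm_eq_abs, sq_abs,
    Real.sq_sqrt (by norm_num)]
  nlinarith [norm_nonneg (star (Q.junk 0 2 1) ⬝ᵥ Q.junk 1 2 1)]

theorem norm_overlap_productEncoding_agentAInv_sq :
    ‖star (productEncoding agentAInv 0) ⬝ᵥ productEncoding agentAInv 1‖ ^ 2 = 1 / 2 := by
  rw [star_productEncoding_dotProduct, Complex.norm_real, Real.norm_eq_abs, sq_abs]
  simp [inputOverlap, Fin.prod_univ_three, Fin.sum_univ_three, agentAInv_mat]

/-! ### Numerical bounds on entropies. -/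

theorem exists_mul_one_sub_eq {d : ℝ} (h0 : 0 ≤ d) (h1 : d ≤ 1 / 4) :
    ∃ t ∈ Set.Icc (0 : ℝ) 2⁻¹, t * (1 - t) = d := by
  have hs := Real.sq_sqrt (show 0 ≤ 1 - 4 * d by linarith)
  have hn := Real.sqrt_nonneg (1 - 4 * d)
  refine ⟨(1 - Real.sqrt (1 - 4 * d)) / 2, ⟨?_, by norm_num; linarith⟩, by linarith⟩
  have : Real.sqrt (1 - 4 * d) ≤ 1 := Real.sqrt_le_one.2 (by linarith)
  linarith

/-- On `[0, 1/2]` both `t * (1 - t)` and the binary entropy increase, so determinants can be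
compared instead of eigenvalues. -/
theorem binEntropy_le_of_mul_one_sub_le {s t : ℝ} (hs : s ∈ Set.Icc (0 : ℝ) 2⁻¹)
    (ht : t ∈ Set.Icc (0 : ℝ) 2⁻¹) (h : s * (1 - s) ≤ t * (1 - t)) :
    Real.binEntropy s ≤ Real.binEntropy t := by
  refine Real.binEntropy_strictMonoOn.monotoneOn hs ht ?_
  obtain ⟨hs0, hs1⟩ := hs
  obtain ⟨ht0, ht1⟩ := ht
  by_contra! hlt
  nlinarith

theorem log_one_sub_mem {x l u : ℝ} (n : ℕ) (hx : |x| < 1)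
    (hl : l ≤ -(∑ i ∈ Finset.range n, x ^ (i + 1) / (i + 1)) - |x| ^ (n + 1) / (1 - |x|))
    (hu : -(∑ i ∈ Finset.range n, x ^ (i + 1) / (i + 1)) + |x| ^ (n + 1) / (1 - |x|) ≤ u) :
    l ≤ Real.log (1 - x) ∧ Real.log (1 - x) ≤ u := by
  have := abs_le.1 (Real.abs_log_sub_add_sum_range_le hx n)
  constructor <;> linarith

/-- The binary entropy at `(1 - z) / 2 ^ k` through logarithms of numbers close to `1`. -/
theorem binEntropy_eq {z t : ℝ} (k : ℕ) (ht : t = (1 - z) / 2 ^ k) (hz : z < 1) :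
    Real.binEntropy t =
      t * (k * Real.log 2 - Real.log (1 - z)) - (1 - t) * Real.log (1 - t) := by
  rw [Real.binEntropy_eq_negMulLog_add_negMulLog_one_sub, Real.negMulLog, Real.negMulLog]
  rw [show Real.log t = Real.log (1 - z) - k * Real.log 2 by
    rw [ht, Real.log_div (by linarith) (by positivity), Real.log_pow]]
  ring

/-- The point lies just below the smaller root, about 0.127322, of `t * (1 - t) = 1 / 9`. The
entropy there exceeds 0.550 bits by only about `4e-5`, hence the many digits. -/
theorem le_binEntropy_inverse : 0.550 * Real.log 2 ≤ Real.binEntropy 0.12732 := by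
  have h1 := log_one_sub_mem (x := -0.01856) (l := 0.018389) (u := 0.018391) 4
    (by norm_num [abs_lt]) (by norm_num [Finset.sum_range_succ, abs_of_neg])
    (by norm_num [Finset.sum_range_succ, abs_of_neg])
  have h2 := log_one_sub_mem (x := 0.12732) (l := -0.136188) (u := -0.136185) 7
    (by norm_num [abs_lt]) (by norm_num [Finset.sum_range_succ, abs_of_pos])
    (by norm_num [Finset.sum_range_succ, abs_of_pos])
  rw [binEntropy_eq (z := -0.01856) 3 (by norm_num) (by norm_num)]
  push_cast
  linarith [Real.log_two_gt_d9, Real.log_two_lt_d9]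

theorem binEntropy_inverse_lt : Real.binEntropy 0.1275 < 0.551 * Real.log 2 := by
  have h1 := log_one_sub_mem (x := -0.02) (l := 0.0198) (u := 0.0199) 3
    (by norm_num [abs_lt]) (by norm_num [Finset.sum_range_succ, abs_of_neg])
    (by norm_num [Finset.sum_range_succ, abs_of_neg])
  have h2 := log_one_sub_mem (x := 0.1275) (l := -0.1364) (u := -0.1363) 6
    (by norm_num [abs_lt]) (by norm_num [Finset.sum_range_succ, abs_of_pos])
    (by norm_num [Finset.sum_range_succ, abs_of_pos])
  rw [binEntropy_eq (z := -0.02) 3 (by norm_num) (by norm_num)]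
  push_cast
  linarith [Real.log_two_gt_d9, Real.log_two_lt_d9]

/-- The eigenvalue for `agentA` is about 0.06227; 0.0622 and 0.0624 enclose it. -/
theorem le_binEntropy_agent : 0.336 * Real.log 2 ≤ Real.binEntropy 0.0622 := by
  have h1 := log_one_sub_mem (x := 0.0048) (l := -0.00482) (u := -0.00481) 3
    (by norm_num [abs_lt]) (by norm_num [Finset.sum_range_succ, abs_of_pos])
    (by norm_num [Finset.sum_range_succ, abs_of_pos])
  have h2 := log_one_sub_mem (x := 0.0622) (l := -0.06422) (u := -0.06421) 6
    (by norm_num [abs_lt]) (by norm_num [Finset.sum_range_succ, abs_of_pos])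
    (by norm_num [Finset.sum_range_succ, abs_of_pos])
  rw [binEntropy_eq (z := 0.0048) 4 (by norm_num) (by norm_num)]
  push_cast
  linarith [Real.log_two_gt_d9, Real.log_two_lt_d9]

theorem binEntropy_agent_lt : Real.binEntropy 0.0624 < 0.337 * Real.log 2 := by
  have h1 := log_one_sub_mem (x := 0.0016) (l := -0.00161) (u := -0.0016) 3
    (by norm_num [abs_lt]) (by norm_num [Finset.sum_range_succ, abs_of_pos])
    (by norm_num [Finset.sum_range_succ, abs_of_pos])
  have h2 := log_one_sub_mem (x := 0.0624) (l := -0.06444) (u := -0.06443) 6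
    (by norm_num [abs_lt]) (by norm_num [Finset.sum_range_succ, abs_of_pos])
    (by norm_num [Finset.sum_range_succ, abs_of_pos])
  rw [binEntropy_eq (z := 0.0016) 4 (by norm_num) (by norm_num)]
  push_cast
  linarith [Real.log_two_gt_d9, Real.log_two_lt_d9]

theorem shannonEntropy_agentDist :
    1.290 ≤ shannonEntropy agentDist ∧ shannonEntropy agentDist < 1.291 := by
  have h := log_one_sub_mem (x := 1 / 24) (l := -0.04257) (u := -0.04255) 5
    (by norm_num [abs_lt]) (by norm_num [Finset.sum_range_succ])
    (by norm_num [Finset.sum_range_succ])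
  have h23 : Real.log 23 = 3 * Real.log 2 + Real.log 3 + Real.log (1 - 1 / 24) := by
    rw [show (23 : ℝ) = 2 ^ 3 * 3 * (1 - 1 / 24) by norm_num, Real.log_mul (by norm_num)
      (by norm_num), Real.log_mul (by norm_num) (by norm_num), Real.log_pow]
    push_cast
    ring
  have l1 : Real.log (2 / 23) = Real.log 2 - Real.log 23 :=
    Real.log_div (by norm_num) (by norm_num)
  have l2 : Real.log (40 / 69) = 3 * Real.log 2 + Real.log 5 - Real.log 3 - Real.log 23 := by
    rw [show (40 / 69 : ℝ) = 2 ^ 3 * 5 / (3 * 23) by norm_num, Real.log_div (by norm_num)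
      (by norm_num), Real.log_mul (by norm_num) (by norm_num),
      Real.log_mul (by norm_num) (by norm_num), Real.log_pow]
    push_cast
    ring
  have e : shannonEntropy agentDist = (1 / 3 * Real.log 3 - 2 / 23 * Real.log (2 / 23) -
      40 / 69 * Real.log (40 / 69)) / Real.log 2 := by
    simp only [shannonEntropy, Fin.sum_univ_three, agentDist, Real.negMulLog]
    simp
    ring
  have g2 := Real.log_two_gt_d9
  have g2' := Real.log_two_lt_d9
  have g3 := Real.log_three_gt_d9
  have g3' := Real.log_three_lt_d9
  have g5 := Real.log_five_gt_d9
  have g5' := Real.log_five_lt_d9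
  rw [e, l1, l2, h23, le_div_iff₀ (by linarith), div_lt_iff₀ (by linarith)]
  constructor <;> linarith

theorem shannonEntropy_inverse :
    0.918 ≤ shannonEntropy (![1 / 3, 2 / 3] : Fin 2 → ℝ) ∧
      shannonEntropy (![1 / 3, 2 / 3] : Fin 2 → ℝ) < 0.919 := by
  have l1 : Real.log (2 / 3) = Real.log 2 - Real.log 3 :=
    Real.log_div (by norm_num) (by norm_num)
  have e : shannonEntropy (![1 / 3, 2 / 3] : Fin 2 → ℝ) =
      (Real.log 3 - 2 / 3 * Real.log 2) / Real.log 2 := by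
    simp only [shannonEntropy, Fin.sum_univ_two, Real.negMulLog]
    simp [l1]
    ring
  have g2 := Real.log_two_gt_d9
  have g2' := Real.log_two_lt_d9
  have g3 := Real.log_three_gt_d9
  have g3' := Real.log_three_lt_d9
  rw [e, le_div_iff₀ (by linarith), div_lt_iff₀ (by linarith)]
  constructor <;> linarith

theorem memoryEntropy_productEncoding_agentA_mem :
    0.336 ≤ memoryEntropy agentDist (productEncoding agentA) ∧
      memoryEntropy agentDist (productEncoding agentA) < 0.337 := by
  have h6 : Real.sqrt 6 ≤ 2.4495 := Real.sqrt_le_iff.2 (by norm_num)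
  have h6' : 2.449 ≤ Real.sqrt 6 := Real.le_sqrt_of_sq_le (by norm_num)
  obtain ⟨t, ht, htd⟩ := exists_mul_one_sub_eq
    (d := (376 - 40 * Real.sqrt 6) / 4761) (by linarith) (by linarith)
  have hlog : 0 < Real.log 2 := Real.log_pos (by norm_num)
  rw [memoryEntropy_productEncoding_agentA htd, le_div_iff₀ hlog, div_lt_iff₀ hlog]
  exact ⟨le_binEntropy_agent.trans (binEntropy_le_of_mul_one_sub_le (by norm_num) ht
      (by rw [htd]; linarith)),
    (binEntropy_le_of_mul_one_sub_le ht (by norm_num) (by rw [htd]; linarith)).trans_lt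
      binEntropy_agent_lt⟩

theorem memoryEntropy_productEncoding_agentAInv_mem :
    0.550 ≤ memoryEntropy ![1 / 3, 2 / 3] (productEncoding agentAInv) ∧
      memoryEntropy ![1 / 3, 2 / 3] (productEncoding agentAInv) < 0.551 := by
  -- `1 / 9` is `2 / 9 * (1 - 1 / 2)`, the determinant at squared overlap 1/2.
  obtain ⟨t, ht, htd⟩ := exists_mul_one_sub_eq (d := 1 / 9) (by norm_num) (by norm_num)
  have hlog : 0 < Real.log 2 := Real.log_pos (by norm_num)
  rw [memoryEntropy_of_overlap (t := t) (by simp [star_productEncoding_dotProduct,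
    inputOverlap_self]) (by rw [htd, norm_overlap_productEncoding_agentAInv_sq]; norm_num),
    le_div_iff₀ hlog, div_lt_iff₀ hlog]
  exact ⟨le_binEntropy_inverse.trans (binEntropy_le_of_mul_one_sub_le (by norm_num) ht
      (by rw [htd]; norm_num)),
    (binEntropy_le_of_mul_one_sub_le ht (by norm_num) (by rw [htd]; norm_num)).trans_lt
      binEntropy_inverse_lt⟩

/-! ### Optimality for the inverse, and the infimum of costs. -/

/-- A larger overlap means a smaller determinant and hence a smaller entropy; the product encoding
has the largest overlap that a model allows. -/
theorem productEncoding_agentAInv_isLeast :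
    IsLeast (quantumCosts agentAInv ![1 / 3, 2 / 3])
      (memoryEntropy ![1 / 3, 2 / 3] (productEncoding agentAInv)) := by
  refine ⟨⟨_, _, _, _, agentAInv_isQuantumEncoding, rfl⟩, ?_⟩
  rintro _ ⟨n, _, _, σ, ⟨K, _, _, Q, rfl⟩, rfl⟩
  have hQ : ∀ i, star (Q.state i) ⬝ᵥ Q.state i = 1 :=
    fun i => (star_dotProduct_self_eq_one_iff _).2 (Q.state_unit i)
  have hc := Q.norm_overlap_sq_le
  obtain ⟨s, hs, hsd⟩ := exists_mul_one_sub_eq (d := 1 / 9) (by norm_num) (by norm_num)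
  obtain ⟨t, ht, htd⟩ := exists_mul_one_sub_eq
    (d := 2 / 9 * (1 - ‖star (Q.state 0) ⬝ᵥ Q.state 1‖ ^ 2)) (by linarith)
    (by linarith [sq_nonneg ‖star (Q.state 0) ⬝ᵥ Q.state 1‖])
  rw [memoryEntropy_of_overlap (t := s) (by simp [star_productEncoding_dotProduct,
    inputOverlap_self]) (by rw [hsd, norm_overlap_productEncoding_agentAInv_sq]; norm_num),
    memoryEntropy_of_overlap hQ htd]
  exact div_le_div_of_nonneg_right (binEntropy_le_of_mul_one_sub_le hs ht (by linarith))
    (Real.log_nonneg (by norm_num))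

theorem quantumCosts_bddBelow {X Y S : Type} [Fintype X] [DecidableEq X] [Fintype Y]
    [DecidableEq Y] [Fintype S] (A : Transducer X Y S) {p : S → ℝ} (hp : ∀ i, 0 ≤ p i)
    (hp1 : ∑ i, p i = 1) : BddBelow (quantumCosts A p) := by
  refine ⟨0, ?_⟩
  rintro _ ⟨n, _, _, σ, ⟨K, _, _, Q, rfl⟩, rfl⟩
  exact memoryEntropy_nonneg hp hp1 Q.state_unit

end AgentComplexity

open AgentComplexity
theorem mainTheorem10 :
    (∃ ε, agentA.IsEpsilonTransducer ε) ∧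
    (∃ ε, agentAInv.IsEpsilonTransducer ε) ∧
    ∃ (O : StationaryProcess (Fin 3))
      (V : Fin 3 → List (Fin 3) → ℝ) (W : Fin 2 → List (Fin 3) → ℝ),
      agentA.Maps inputProcess V O ∧
      agentAInv.Maps O W inputProcess ∧
      -- classical complexities
      (1.290 ≤ shannonEntropy (stateDist V) ∧ shannonEntropy (stateDist V) < 1.291) ∧
      (0.918 ≤ shannonEntropy (stateDist W) ∧ shannonEntropy (stateDist W) < 0.919) ∧
      shannonEntropy (stateDist W) < shannonEntropy (stateDist V) ∧
      -- quantum complexities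
      ∃ QA QAinv : ℝ,
        IsGLB (quantumCosts agentA (stateDist V)) QA ∧
        IsQuantumEncoding agentA (productEncoding agentA) ∧
        QA ≤ memoryEntropy (stateDist V) (productEncoding agentA) ∧
        (0.336 ≤ memoryEntropy (stateDist V) (productEncoding agentA) ∧
          memoryEntropy (stateDist V) (productEncoding agentA) < 0.337) ∧
        IsLeast (quantumCosts agentAInv (stateDist W)) QAinv ∧
        IsQuantumEncoding agentAInv (productEncoding agentAInv) ∧
        QAinv = memoryEntropy (stateDist W) (productEncoding agentAInv) ∧
        (0.550 ≤ QAinv ∧ QAinv < 0.551) ∧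
        QA < QAinv := by
  refine ⟨agentA_isEpsilonTransducer, agentAInv_isEpsilonTransducer, outputProcess, agentLaw,
    inverseLaw, agentA_maps, agentAInv_maps, ?_⟩
  rw [stateDist_agentLaw, stateDist_inverseLaw]
  have hA := memoryEntropy_productEncoding_agentA_mem
  have hI := memoryEntropy_productEncoding_agentAInv_mem
  -- Nonemptiness and the lower bound 0 make `sInf` a genuine infimum; whether it is attained is
  -- irrelevant, because the upper bound from the product encoding suffices.
  have hglb : IsGLB (quantumCosts agentA agentDist) (sInf (quantumCosts agentA agentDist)) :=
    isGLB_csInf ⟨_, _, _, _, _, agentA_isQuantumEncoding, rfl⟩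
      (quantumCosts_bddBelow agentA agentDist_nonneg
        (by simp [agentDist, Fin.sum_univ_three]; norm_num))
  have hle : sInf (quantumCosts agentA agentDist) ≤
      memoryEntropy agentDist (productEncoding agentA) :=
    hglb.1 ⟨_, _, _, _, agentA_isQuantumEncoding, rfl⟩
  exact ⟨shannonEntropy_agentDist, shannonEntropy_inverse,
    by linarith [shannonEntropy_agentDist.1, shannonEntropy_inverse.2], _, _, hglb,
    agentA_isQuantumEncoding, hle, hA, productEncoding_agentAInv_isLeast,
    agentAInv_isQuantumEncoding, rfl, hI, by linarith [hA.2, hI.1]⟩
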